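/- **Proposition (Inference algorithm).** Let $\mathcal X,\mathcal Y,\mathcal E_0$ be finite sets with $|\mathcal X|=n$, $|\mathcal Y|=m$ and $|\mathcal E_0|<n(m-1)$. Let $f:\mathcal X\times\mathcal E_0\to\mathcal Y$ be *generic*: for every $y\in\mathcal Y$ the sets $f_x^{-1}(y)=\{e\in\mathcal E_0: f(x,e)=y\}$, $x\in\mathcal X$, are nonempty and pairwise different. Draw the distribution $p_X$ of $X$ and the distribution $p_{E_0}$ of $E_0$ independently and uniformly at random from the probability simplices over $\mathcal X$ and over $\mathcal E_0$. Given these, let $X\sim p_X$ and $E_0\sim p_{E_0}$ be independent, put $Y=f(X,E_0)$ (the causal model $X\to Y$), and let $p(x,y)$ be the resulting joint distribution of $(X,Y)$. A finite-valued exogenous variable $E$ explains $p$ in the direction $X\to Y$ if $p$ is the joint distribution of $(X,h(X,E))$ for some deterministic function $h$, with $E$ independent of $X$. Likewise $\tilde E$ explains $p$ in the direction $Y\to X$ if $p$ is the joint distribution of $(g(Y,\tilde E),Y)$ for some deterministic function $g$, with $\tilde E$ independent of $Y$. The cardinality $|E|$ (resp. $|\tilde E|$) is the number of states of the variable. Then,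 with probability $1$ over the choice of $(p_X,p_{E_0})$, exogenous variables of minimum cardinality exist in both directions, and any exogenous variables $E$ for $X\to Y$ and $\tilde E$ for $Y\to X$ that have minimum cardinality among all those explaining $p$ in their direction satisfy $$|X|+|E|<|Y|+|\tilde E|,\qquad\text{i.e.}\qquad n+|E|<m+|\tilde E|.$$ -/

import Mathlib

open MeasureTheory

noncomputable section

/-- The probability simplex over a finite index set `ι`, i.e. the set of all probability
distributions on `ι`, as a subset of the Euclidean space `ℝ^ι`. -/
def probSimplex (ι : Type*) [Fintype ι] : Set (EuclideanSpace ℝ ι) :=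
  {x | (∀ i, 0 ≤ x i) ∧ ∑ i, x i = 1}

/-- The uniform distribution on the probability simplex over `ι`: the normalised surface measure,
that is, the Hausdorff measure of dimension `|ι| - 1` of the simplex (for the Euclidean distance),
divided by its total mass. -/
def uniformSimplex (ι : Type*) [Fintype ι] : Measure (probSimplex ι) :=
  ProbabilityTheory.cond (Measure.hausdorffMeasure ((Fintype.card ι : ℝ) - 1)) Set.univ

instance (ι : Type*) [Fintype ι] : SFinite (uniformSimplex ι) := by
  unfold uniformSimplex; infer_instance

/-- `uniformSimplex ι` is a probability measure: the surface measure of the simplex is positive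
and finite. -/
instance (ι : Type*) [Fintype ι] [Nonempty ι] : IsProbabilityMeasure (uniformSimplex ι) := by
  classical
  obtain ⟨i₀⟩ := ‹Nonempty ι›
  have hcard : ((Fintype.card ι : ℝ) - 1) = (Fintype.card {i : ι // i ≠ i₀} : ℝ) := by
    have h1 : Fintype.card {i : ι // i ≠ i₀} = Fintype.card ι - 1 := by
      simp [Fintype.card_subtype_compl]
    have h2 : 1 ≤ Fintype.card ι := Fintype.card_pos_iff.2 ⟨i₀⟩
    rw [h1, Nat.cast_sub h2, Nat.cast_one]
  have hd : (0 : ℝ) ≤ (Fintype.card {i : ι // i ≠ i₀} : ℝ) := Nat.cast_nonneg _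
  have hsum : ∀ x : ι → ℝ, ∑ i, x i = x i₀ + ∑ i : {i : ι // i ≠ i₀}, x i := fun x => by
    rw [Fintype.sum_eq_add_sum_subtype_ne x i₀]
  have himg : Measure.hausdorffMeasure ((Fintype.card ι : ℝ) - 1)
      (Set.univ : Set (probSimplex ι)) =
      Measure.hausdorffMeasure (Fintype.card {i : ι // i ≠ i₀} : ℝ) (probSimplex ι) := by
    rw [hcard, ← isometry_subtype_coe.hausdorffMeasure_image (Or.inl hd)]
    simp
  unfold uniformSimplex
  apply ProbabilityTheory.cond_isProbabilityMeasure_of_finite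
  · rw [himg]
    let P : EuclideanSpace ℝ ι → ({i : ι // i ≠ i₀} → ℝ) := fun x i => x i
    have hP : LipschitzWith 1 P := by
      refine LipschitzWith.of_dist_le_mul fun x y => ?_
      rw [NNReal.coe_one, one_mul]
      refine (dist_pi_le_iff dist_nonneg).2 fun i => ?_
      rw [dist_eq_norm, dist_eq_norm]
      exact PiLp.norm_apply_le (x - y) (i : ι)
    have hN : (0 : ℝ) < Fintype.card ι := Nat.cast_pos.2 (Fintype.card_pos_iff.2 ⟨i₀⟩)
    have hsub : Set.pi Set.univ (fun _ : {i : ι // i ≠ i₀} =>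
        Set.Icc (0 : ℝ) (1 / Fintype.card ι)) ⊆ P '' probSimplex ι := by
      intro v hv
      have hv' : ∀ i, 0 ≤ v i ∧ v i ≤ 1 / Fintype.card ι := fun i => hv i trivial
      have hle : ∑ i, v i ≤ 1 := by
        calc ∑ i, v i ≤ ∑ _i : {i : ι // i ≠ i₀}, 1 / (Fintype.card ι : ℝ) :=
              Finset.sum_le_sum fun i _ => (hv' i).2
          _ = ((Fintype.card ι : ℝ) - 1) / Fintype.card ι := by
              rw [Finset.sum_const, Finset.card_univ, nsmul_eq_mul, ← hcard]; ring
          _ ≤ 1 := by rw [div_le_one hN]; linarith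
      let w : ι → ℝ := fun i => if h : i = i₀ then 1 - ∑ i, v i else v ⟨i, h⟩
      have hw0 : w i₀ = 1 - ∑ i, v i := by simp [w]
      have hw : ∀ i : {i : ι // i ≠ i₀}, w i = v i := fun i => by simp [w, i.2]
      refine ⟨WithLp.toLp 2 w, ⟨fun i => ?_, ?_⟩, funext fun i => hw i⟩
      · by_cases h : i = i₀
        · subst h; change 0 ≤ w i; rw [hw0]; linarith
        · change 0 ≤ w i; rw [hw ⟨i, h⟩]; exact (hv' _).1
      · change ∑ i, w i = 1
        rw [hsum w, hw0, Finset.sum_congr rfl fun i _ => hw i]; ring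
    intro h0
    have h1 := hP.hausdorffMeasure_image_le hd (probSimplex ι)
    rw [h0, mul_zero] at h1
    have h2 := (measure_mono hsub).trans h1
    rw [hausdorffMeasure_pi_real, volume_pi_pi] at h2
    simp only [Real.volume_Icc, sub_zero, Finset.prod_const] at h2
    have h3 : ENNReal.ofReal (1 / (Fintype.card ι : ℝ)) ≠ 0 := by
      simp
    exact pow_ne_zero _ h3 (le_antisymm h2 bot_le)
  · rw [himg]
    let L : ({i : ι // i ≠ i₀} → ℝ) →ₗ[ℝ] EuclideanSpace ℝ ι :=
      { toFun := fun v => WithLp.toLp 2 fun i => if h : i = i₀ then - ∑ i, v i else v ⟨i, h⟩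
        map_add' := fun v w => by
          ext i
          by_cases h : i = i₀ <;> simp [h, Finset.sum_add_distrib, add_comm]
        map_smul' := fun c v => by
          ext i
          by_cases h : i = i₀ <;> simp [h, Finset.mul_sum] }
    let b : EuclideanSpace ℝ ι := EuclideanSpace.single i₀ 1
    obtain ⟨K, hK⟩ : ∃ K, LipschitzWith K fun v => L v + b :=
      ⟨_, (LinearMap.toContinuousLinearMap L).lipschitz.add (LipschitzWith.const b)⟩
    have hsub : probSimplex ι ⊆ (fun v => L v + b) ''
        Set.pi Set.univ (fun _ : {i : ι // i ≠ i₀} => Set.Icc (0 : ℝ) 1) := by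
      rintro x ⟨hx0, hx1⟩
      refine ⟨fun i => x i, fun i _ => ⟨hx0 i, ?_⟩, ?_⟩
      · rw [← hx1]
        exact Finset.single_le_sum (fun j _ => hx0 j) (Finset.mem_univ (i : ι))
      · ext i
        have h := hsum x
        rw [hx1] at h
        by_cases hi : i = i₀
        · subst hi
          simp [L, b]; linarith
        · simp [L, b, hi]
    refine ne_top_of_le_ne_top ?_ ((measure_mono hsub).trans (hK.hausdorffMeasure_image_le hd _))
    rw [hausdorffMeasure_pi_real, volume_pi_pi]
    refine ENNReal.mul_ne_top (ENNReal.rpow_ne_top_of_nonneg hd ENNReal.coe_ne_top) ?_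
    simp

/-- A causal model `C → W` on two observed variables with finite alphabets `𝒞` (the cause `C`) and
`𝒲` (the effect `W`), and one exogenous variable `E` with alphabet `ℰ`. It consists of the
distribution of `C`, the distribution of `E`, and a deterministic function `f`. The variables
`C` and `E` are independent and `W = f(C, E)`. -/
structure CausalModel (𝒞 𝒲 ℰ : Type*) [Fintype 𝒞] [Fintype ℰ] where
  cause : probSimplex 𝒞
  exo : probSimplex ℰ
  f : 𝒞 → ℰ → 𝒲

namespace CausalModel

variable {𝒞 𝒲 ℰ : Type*} [Fintype 𝒞] [Fintype ℰ]

/-- The joint distribution of the cause and the exogenous variable, which are independent. -/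
def jointExo (M : CausalModel 𝒞 𝒲 ℰ) (c : 𝒞) (e : ℰ) : ℝ :=
  M.cause.1 c * M.exo.1 e

open Classical in
/-- The joint distribution of the observed pair `(C, W) = (C, f(C, E))` induced by the model. -/
def observed (M : CausalModel 𝒞 𝒲 ℰ) (c : 𝒞) (w : 𝒲) : ℝ :=
  ∑ e with M.f c e = w, M.jointExo c e

/-- `M` explains the joint distribution `p` of a pair `(C, W)` in the direction `C → W`, and
its exogenous variable has the minimum cardinality among all models `C → W` that do so. (A finite
alphabet of size `k` is `Fin k` up to relabelling. States of probability zero may be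
deleted, so counting the alphabet or the support gives the same minimum.) -/
def IsMinimalFor (M : CausalModel 𝒞 𝒲 ℰ) (p : 𝒞 → 𝒲 → ℝ) : Prop :=
  M.observed = p ∧
    ∀ (k : ℕ) (M' : CausalModel 𝒞 𝒲 (Fin k)), M'.observed = p → Fintype.card ℰ ≤ k

end CausalModel

/-- A function `f : 𝒳 × ℰ → 𝒴` is generic if for every `y` the sets `f_x⁻¹(y) ⊆ ℰ`, for
`x ∈ 𝒳`, are nonempty and pairwise different. -/
def GenericFunction {𝒳 𝒴 ℰ : Type*} (f : 𝒳 → ℰ → 𝒴) : Prop :=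
  (∀ x₁ x₂ y, x₁ ≠ x₂ → f x₁ ⁻¹' {y} ≠ f x₂ ⁻¹' {y}) ∧ ∀ x y, (f x ⁻¹' {y}).Nonempty

end

/-! The true model bounds the minimal `E` by `|ℰ₀| < n(m - 1)`, so it suffices that almost surely
every reverse model needs at least `m(n - 1)` states. A reverse model with functions `g` makes the
conditionals `P(x | y)` a convex combination of `l` deterministic maps `𝒴 → 𝒳`. If `l < m(n - 1)`,
dimension counting (`exists_relation_of_card_lt`) gives coefficients `c`, dependent on `g` alone,
whose sum along each of these maps is zero, with some `c y` not constant. Hence `∑ c y x * P(x | y)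
= 0` (`posteriorForm_eq_zero`). With denominators cleared this is a polynomial equation in the two
random distributions. Genericity of `f` makes it nontrivial, so it holds only on a null set
(`ae_posteriorForm_ne_zero`). There are countably many pairs `(l, g)`, so one null set serves for
all. -/

noncomputable section

/-! ### Zero sets of analytic functions, in a vector space and on the simplex. -/

/-- A real-analytic function on a finite-dimensional space which is not identically zero vanishes
only on a null set. -/
theorem AnalyticOnNhd.ae_ne_zero {E : Type*} [NormedAddCommGroup E] [NormedSpace ℝ E]
    [FiniteDimensional ℝ E] [MeasurableSpace E] [BorelSpace E] (μ : Measure E)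
    [μ.IsAddHaarMeasure] {F : E → ℝ} (hF : AnalyticOnNhd ℝ F Set.univ) {x₀ : E} (hx₀ : F x₀ ≠ 0) :
    ∀ᵐ x ∂μ, F x ≠ 0 := by
  -- On a line through `x₀` the restriction is nonzero at `t = 0`, so its zeros are discrete. Fubini
  -- then yields one `t ≠ 0` good for almost every `x`, and `x ↦ x₀ + t • x` preserves null sets in
  -- both directions.
  have hline : ∀ x : E, ∀ᵐ t : ℝ, F (x₀ + t • x) ≠ 0 := by
    intro x
    have han : AnalyticOnNhd ℝ (fun t : ℝ => F (x₀ + t • x)) Set.univ := fun t _ =>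
      (hF (x₀ + t • x) trivial).fun_comp (f := fun t : ℝ => x₀ + t • x) (by fun_prop)
    have h := han.preimage_zero_mem_codiscrete (x := 0) (by simpa using hx₀)
    have h' := ae_restrict_le_codiscreteWithin (μ := (volume : Measure ℝ)) MeasurableSet.univ h
    rw [Measure.restrict_univ] at h'
    exact h'
  have hcont : Continuous F := continuousOn_univ.1 hF.continuousOn
  have hmeas : MeasurableSet {z : E × ℝ | F (x₀ + z.2 • z.1) ≠ 0} :=
    (isOpen_ne_fun (by fun_prop) continuous_const).measurableSet
  have hswap : ∀ᵐ t : ℝ, ∀ᵐ x ∂μ, F (x₀ + t • x) ≠ 0 :=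
    (Measure.ae_ae_comm (p := fun x t => F (x₀ + t • x) ≠ 0) hmeas).1 (ae_of_all _ hline)
  have hne : ∀ᵐ t : ℝ, t ≠ 0 := Measure.ae_ne volume 0
  obtain ⟨t, ht, ht0⟩ := (hswap.and hne).exists
  have h1 : μ ((t • ·) ⁻¹' ((x₀ + ·) ⁻¹' {x | ¬ F x ≠ 0})) = 0 := ht
  rw [Measure.addHaar_preimage_smul μ ht0, measure_preimage_add] at h1
  refine (mul_eq_zero.1 h1).resolve_left ?_
  simp [ht0]

/-- A real-analytic function which is nonzero somewhere on the affine hyperplane spanned by the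
simplex is almost surely nonzero at a uniformly chosen point of the simplex. -/
theorem ae_uniformSimplex_ne_zero {ι : Type*} [Fintype ι] {F : (ι → ℝ) → ℝ}
    (hF : AnalyticOnNhd ℝ F Set.univ) {x₀ : ι → ℝ} (hsum₀ : ∑ i, x₀ i = 1) (hx₀ : F x₀ ≠ 0) :
    ∀ᵐ x ∂uniformSimplex ι, F (fun i => x.1 i) ≠ 0 := by
  classical
  obtain ⟨i₀⟩ : Nonempty ι := by
    by_contra h
    rw [not_nonempty_iff] at h
    simp at hsum₀
  have hcard : ((Fintype.card ι : ℝ) - 1) = (Fintype.card {i : ι // i ≠ i₀} : ℝ) := by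
    have h1 : Fintype.card {i : ι // i ≠ i₀} = Fintype.card ι - 1 := by
      simp [Fintype.card_subtype_compl]
    have h2 : 1 ≤ Fintype.card ι := Fintype.card_pos_iff.2 ⟨i₀⟩
    rw [h1, Nat.cast_sub h2, Nat.cast_one]
  have hd : (0 : ℝ) ≤ (Fintype.card {i : ι // i ≠ i₀} : ℝ) := Nat.cast_nonneg _
  -- An affine chart of the hyperplane of coordinate sum `1`, omitting the coordinate `i₀`. Being
  -- Lipschitz, it carries Lebesgue-null sets to sets that are null for the Hausdorff measure.
  let A : ({i : ι // i ≠ i₀} → ℝ) → ι → ℝ := fun v i =>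
    if h : i = i₀ then 1 - ∑ j, v j else v ⟨i, h⟩
  have hA : ∀ x : ι → ℝ, ∑ i, x i = 1 → A (fun i => x i) = x := by
    intro x hx
    rw [Fintype.sum_eq_add_sum_subtype_ne x i₀] at hx
    funext i
    by_cases h : i = i₀
    · subst h; simp only [A, dite_true]; linarith
    · simp [A, h]
  have hAan : ∀ v, AnalyticAt ℝ A v := by
    intro v
    rw [analyticAt_pi_iff]
    intro i
    by_cases h : i = i₀
    · simp only [h, dite_true]
      exact analyticAt_const.sub (Finset.analyticAt_fun_sum _ fun j _ =>
        (ContinuousLinearMap.proj (R := ℝ) (φ := fun _ : {i : ι // i ≠ i₀} => ℝ) j).analyticAt v)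
    · simp only [h, dite_false]
      exact (ContinuousLinearMap.proj (R := ℝ) (φ := fun _ : {i : ι // i ≠ i₀} => ℝ)
        ⟨i, h⟩).analyticAt v
  have hnull : ∀ᵐ v : {i : ι // i ≠ i₀} → ℝ, F (A v) ≠ 0 := by
    refine AnalyticOnNhd.ae_ne_zero (F := fun v => F (A v)) volume
      (fun v _ => (hF (A v) trivial).fun_comp (hAan v)) (x₀ := fun i => x₀ i) ?_
    rwa [hA x₀ hsum₀]
  obtain ⟨K, hK⟩ : ∃ K, LipschitzWith K fun v => WithLp.toLp 2 (A v) := by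
    let L : ({i : ι // i ≠ i₀} → ℝ) →ₗ[ℝ] EuclideanSpace ℝ ι :=
      { toFun := fun v => WithLp.toLp 2 fun i => if h : i = i₀ then - ∑ i, v i else v ⟨i, h⟩
        map_add' := fun v w => by
          ext i
          by_cases h : i = i₀ <;> simp [h, Finset.sum_add_distrib, add_comm]
        map_smul' := fun c v => by
          ext i
          by_cases h : i = i₀ <;> simp [h, Finset.mul_sum] }
    have h := (LinearMap.toContinuousLinearMap L).lipschitz.add
      (LipschitzWith.const (EuclideanSpace.single i₀ (1 : ℝ)))
    refine ⟨_, (congrArg (LipschitzWith _) (funext fun v => ?_)).mp h⟩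
    ext i
    by_cases h : i = i₀
    · simp [A, L, h]; ring
    · simp [A, L, h]
  have hae : ∀ᵐ x ∂(Measure.hausdorffMeasure ((Fintype.card ι : ℝ) - 1) :
      Measure (probSimplex ι)), F (fun i => x.1 i) ≠ 0 := by
    rw [ae_iff, hcard, ← isometry_subtype_coe.hausdorffMeasure_image (Or.inl hd)]
    refine measure_mono_null (t := (fun v => WithLp.toLp 2 (A v)) '' {v | ¬ F (A v) ≠ 0}) ?_ ?_
    · rintro _ ⟨x, hx, rfl⟩
      have hAx := hA (fun i => x.1 i) x.2.2
      refine ⟨fun i => x.1 i, ?_, ?_⟩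
      · simpa only [Set.mem_ofPred_eq, hAx] using hx
      · ext i
        exact congrFun hAx i
    · refine le_antisymm ((hK.hausdorffMeasure_image_le hd _).trans_eq ?_) bot_le
      rw [hausdorffMeasure_pi_real, ae_iff.1 hnull, mul_zero]
  exact (ProbabilityTheory.cond_absolutelyContinuous (s := Set.univ)).ae_le hae

/-! ### General position of the response probabilities. -/

/-- A finite family of linear forms, none of which is a multiple of a given form `d`, can be made
nonzero simultaneously at a point of the kernel of `d` with coordinate sum `1`, provided that the
coordinate sum is not a multiple of `d` either. -/
theorem exists_sum_eq_one_and_sum_mul_ne_zero {ι κ : Type*} [Fintype ι] [Finite κ] (d : ι → ℝ)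
    (a : κ → ι → ℝ) (hone : ∀ r : ℝ, (fun _ => 1) ≠ r • d) (ha : ∀ k, ∀ r : ℝ, a k ≠ r • d) :
    ∃ x : ι → ℝ, ∑ i, x i = 1 ∧ ∑ i, d i * x i = 0 ∧ ∀ k, ∑ i, a k i * x i ≠ 0 := by
  have key : ∀ b : ι → ℝ, (∀ r : ℝ, b ≠ r • d) → ∃ x : ι → ℝ, d ⬝ᵥ x = 0 ∧ b ⬝ᵥ x ≠ 0 := by
    intro b hb
    -- The witness is the component of `b` orthogonal to `d`; for `d = 0` division by zero gives `r
    -- = 0` and the witness is `b`.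
    set r := (d ⬝ᵥ b) / (d ⬝ᵥ d) with hr
    have hdx : d ⬝ᵥ (b - r • d) = 0 := by
      rw [dotProduct_sub, dotProduct_smul, smul_eq_mul]
      by_cases hd : d ⬝ᵥ d = 0
      · simp [dotProduct_self_eq_zero.1 hd]
      · rw [hr]; field_simp; ring
    refine ⟨b - r • d, hdx, fun h => hb r (sub_eq_zero.1 (dotProduct_self_eq_zero.1 ?_))⟩
    rw [sub_dotProduct, h, smul_dotProduct, hdx, smul_zero, sub_zero]
  let form : (ι → ℝ) → Module.Dual ℝ (ι → ℝ) := fun b =>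
    { toFun := fun x => b ⬝ᵥ x
      map_add' := fun x y => dotProduct_add b x y
      map_smul' := fun s x => dotProduct_smul s b x }
  obtain ⟨x, hx, hne⟩ := Module.Dual.exists_forall_mem_ne_zero_of_forall_exists
    (LinearMap.ker (form d)) (fun o : Option κ => o.elim (form fun _ => 1) fun k => form (a k))
    (by rintro (_ | k)
        · exact key _ hone
        · exact key _ (ha k))
  have hs : ∑ i, x i ≠ 0 := by simpa [form, dotProduct] using hne none
  have hd : ∑ i, d i * x i = 0 := hx
  have hscale : ∀ b : ι → ℝ,
      ∑ i, b i * (x i / ∑ j, x j) = (∑ i, b i * x i) / ∑ j, x j := fun b => by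
    rw [Finset.sum_div]
    exact Finset.sum_congr rfl fun i _ => (mul_div_assoc _ _ _).symm
  refine ⟨fun i => x i / ∑ j, x j, ?_, ?_, fun k => ?_⟩
  · rw [← Finset.sum_div, div_self hs]
  · rw [hscale, hd, zero_div]
  · rw [hscale]
    exact div_ne_zero (hne (some k)) hs

theorem analyticAt_sum_mul {ι : Type*} [Fintype ι] (a x : ι → ℝ) :
    AnalyticAt ℝ (fun x : ι → ℝ => ∑ i, a i * x i) x :=
  Finset.analyticAt_fun_sum _ fun i _ => analyticAt_const.mul
    ((ContinuousLinearMap.proj (R := ℝ) (φ := fun _ : ι => ℝ) i).analyticAt x)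

open Classical in
/-- The probability of the effect `y` given the cause `x`, for the weights `q` of the exogenous
states. -/
def responseProb {𝒳 𝒴 ℰ : Type*} [Fintype ℰ] (f : 𝒳 → ℰ → 𝒴) (q : ℰ → ℝ) (x : 𝒳) (y : 𝒴) : ℝ :=
  ∑ e, (if f x e = y then 1 else 0) * q e

/-- The conditional distributions `Q` of the effect given the cause are in general position. -/
structure GenericResponse {𝒳 𝒴 : Type*} (Q : 𝒳 → 𝒴 → ℝ) : Prop where
  pos : ∀ x y, 0 < Q x y
  ne : ∀ x₁ x₂ y, x₁ ≠ x₂ → Q x₁ y ≠ Q x₂ y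
  cross : ∀ x₁ x₂ y₁ y₂, x₁ ≠ x₂ → y₁ ≠ y₂ → Q x₁ y₁ * Q x₂ y₂ - Q x₁ y₂ * Q x₂ y₁ ≠ 0

/-- A generic function has a generic response for almost every distribution of the exogenous
variable. -/
theorem GenericFunction.ae_genericResponse {𝒳 𝒴 ℰ : Type*} [Fintype 𝒳] [Fintype 𝒴] [Fintype ℰ]
    {f : 𝒳 → ℰ → 𝒴} (hf : GenericFunction f) :
    ∀ᵐ q ∂uniformSimplex ℰ, GenericResponse (responseProb f fun e => q.1 e) := by
  classical
  have hpos : ∀ᵐ q ∂uniformSimplex ℰ, ∀ e, q.1 e ≠ 0 := by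
    refine ae_all_iff.2 fun e => ?_
    exact ae_uniformSimplex_ne_zero (F := fun q => q e) (x₀ := Pi.single e 1)
      (fun x _ => (ContinuousLinearMap.proj (R := ℝ) (φ := fun _ : ℰ => ℝ) e).analyticAt x)
      (by simp) (by simp)
  have han : ∀ x y, AnalyticOnNhd ℝ (fun q => responseProb f q x y) Set.univ :=
    fun x y q _ => analyticAt_sum_mul _ q
  have hne : ∀ᵐ q ∂uniformSimplex ℰ, ∀ x₁ x₂ y, x₁ ≠ x₂ →
      responseProb f (fun e => q.1 e) x₁ y - responseProb f (fun e => q.1 e) x₂ y ≠ 0 := by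
    simp_rw [ae_all_iff]
    intro x₁ x₂ y hx
    obtain ⟨e₀, -⟩ := hf.2 x₁ y
    -- With `d = 0` the kernel condition is void.
    obtain ⟨q, hq, -, h⟩ := exists_sum_eq_one_and_sum_mul_ne_zero (0 : ℰ → ℝ)
      (fun (_ : Unit) e => (if f x₁ e = y then 1 else 0) - (if f x₂ e = y then 1 else 0))
      (fun r h => by simpa using congrFun h e₀)
      (fun _ r h => hf.1 x₁ x₂ y hx (Set.ext fun e => by
        have h' := congrFun h e
        by_cases h1 : f x₁ e = y <;> by_cases h2 : f x₂ e = y <;> simp_all))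
    refine ae_uniformSimplex_ne_zero
      (F := fun q => responseProb f q x₁ y - responseProb f q x₂ y)
      ((han x₁ y).sub (han x₂ y)) hq ?_
    simpa only [responseProb, ← Finset.sum_sub_distrib, ← sub_mul] using h ()
  have hcross : ∀ᵐ q ∂uniformSimplex ℰ, ∀ x₁ x₂ y₁ y₂, x₁ ≠ x₂ → y₁ ≠ y₂ →
      responseProb f (fun e => q.1 e) x₁ y₁ * responseProb f (fun e => q.1 e) x₂ y₂ -
        responseProb f (fun e => q.1 e) x₁ y₂ * responseProb f (fun e => q.1 e) x₂ y₁ ≠ 0 := by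
    simp_rw [ae_all_iff]
    intro x₁ x₂ y₁ y₂ hx hy
    obtain ⟨e₀, he₀⟩ := hf.2 x₁ y₂
    obtain ⟨e₁, he₁⟩ := hf.2 x₂ y₁
    simp only [Set.mem_preimage, Set.mem_singleton_iff] at he₀ he₁
    -- Weights, possibly negative, that annihilate the entry `(x₁, y₁)` reduce the minor to minus
    -- the product of the entries `(x₁, y₂)` and `(x₂, y₁)`. Neither indicator is a multiple of that
    -- of `(x₁, y₁)`: the first has a disjoint nonempty support, the second a different nonempty
    -- one.
    obtain ⟨q, hq, h0, h⟩ := exists_sum_eq_one_and_sum_mul_ne_zero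
      (fun e => if f x₁ e = y₁ then (1 : ℝ) else 0)
      (fun (b : Bool) e => if b then (if f x₁ e = y₂ then (1 : ℝ) else 0)
        else (if f x₂ e = y₁ then (1 : ℝ) else 0))
      (fun r h => by simpa [he₀, hy.symm] using congrFun h e₀)
      (by
        rintro (_ | _) r h
        · have h1 := congrFun h e₁
          by_cases h2 : f x₁ e₁ = y₁
          · have hr : r = 1 := by simpa [he₁, h2] using h1.symm
            subst hr
            refine hf.1 x₁ x₂ y₁ hx (Set.ext fun e => ?_)
            have h' := congrFun h e
            by_cases h1 : f x₁ e = y₁ <;> by_cases h2 : f x₂ e = y₁ <;> simp_all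
          · simp [he₁, h2] at h1
        · simpa [he₀, hy.symm] using congrFun h e₀)
    refine ae_uniformSimplex_ne_zero
      (F := fun q => responseProb f q x₁ y₁ * responseProb f q x₂ y₂ -
        responseProb f q x₁ y₂ * responseProb f q x₂ y₁)
      (((han x₁ y₁).mul (han x₂ y₂)).sub ((han x₁ y₂).mul (han x₂ y₁))) hq ?_
    have h0' : responseProb f q x₁ y₁ = 0 := h0
    have ht : responseProb f q x₁ y₂ ≠ 0 := h true
    have hf : responseProb f q x₂ y₁ ≠ 0 := h false
    simp [h0', ht, hf]
  filter_upwards [hpos, hne, hcross] with q h1 h2 h3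
  refine ⟨fun x y => ?_, fun x₁ x₂ y hx => sub_ne_zero.1 (h2 x₁ x₂ y hx), h3⟩
  obtain ⟨e, he⟩ := hf.2 x y
  refine Finset.sum_pos' (fun e _ => mul_nonneg (by split_ifs <;> norm_num) (q.2.1 e))
    ⟨e, Finset.mem_univ e, ?_⟩
  rw [if_pos (show f x e = y from he), one_mul]
  exact lt_of_le_of_ne (q.2.1 e) (h1 e).symm

/-! ### The cleared-denominator form and its nonvanishing. -/

open Classical in
/-- The numerator of `∑ y x, c y x * P(x | y)` over the common denominator `∏ y, P(y)`, for the
cause distribution `p` and the conditional distributions `Q` of the effect. -/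
def posteriorForm {𝒳 𝒴 : Type*} [Fintype 𝒳] [Fintype 𝒴] (c : 𝒴 → 𝒳 → ℝ) (Q : 𝒳 → 𝒴 → ℝ)
    (p : 𝒳 → ℝ) : ℝ :=
  ∑ y, (∑ x, c y x * Q x y * p x) * ∏ y' ∈ Finset.univ.erase y, ∑ x, Q x y' * p x

/-- Choose a signed `p` for which the effect `y₀` has total weight zero. Every summand except that
of `y₀` then contains a zero factor. The surviving one can be kept nonzero: `c y₀` is not constant,
so its numerator is not a multiple of the vanishing form, and the nonzero minors exclude this for
the other denominators. -/
theorem GenericResponse.exists_posteriorForm_ne_zero {𝒳 𝒴 : Type*} [Fintype 𝒳] [Fintype 𝒴]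
    {Q : 𝒳 → 𝒴 → ℝ} (hQ : GenericResponse Q) {c : 𝒴 → 𝒳 → ℝ} {y₀ : 𝒴} {x₁ x₂ : 𝒳}
    (hc : c y₀ x₁ ≠ c y₀ x₂) : ∃ p : 𝒳 → ℝ, ∑ x, p x = 1 ∧ posteriorForm c Q p ≠ 0 := by
  classical
  have hx : x₁ ≠ x₂ := fun h => hc (h ▸ rfl)
  obtain ⟨p, hp, h0, h⟩ := exists_sum_eq_one_and_sum_mul_ne_zero (fun x => Q x y₀)
    (fun (o : Option {y // y ≠ y₀}) x => o.elim (c y₀ x * Q x y₀) fun y => Q x y)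
    (fun r h => by
      have h1 := congrFun h x₁
      have h2 := congrFun h x₂
      simp only [Pi.smul_apply, smul_eq_mul] at h1 h2
      have hr : r ≠ 0 := by rintro rfl; simp at h1
      exact hQ.ne x₁ x₂ y₀ hx (mul_left_cancel₀ hr (h1.symm.trans h2)))
    (by
      rintro (_ | ⟨y, hy⟩) r h
      · have h1 := mul_right_cancel₀ (hQ.pos x₁ y₀).ne' (congrFun h x₁)
        have h2 := mul_right_cancel₀ (hQ.pos x₂ y₀).ne' (congrFun h x₂)
        exact hc (h1.trans h2.symm)
      · have h1 : Q x₁ y = r * Q x₁ y₀ := congrFun h x₁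
        have h2 : Q x₂ y = r * Q x₂ y₀ := congrFun h x₂
        refine hQ.cross x₁ x₂ y y₀ hx hy ?_
        rw [h1, h2]; ring)
  refine ⟨p, hp, ?_⟩
  rw [posteriorForm, Finset.sum_eq_single y₀]
  · refine mul_ne_zero (h none) (Finset.prod_ne_zero_iff.2 fun y hy => ?_)
    exact h (some ⟨y, (Finset.mem_erase.1 hy).1⟩)
  · intro y _ hy
    rw [Finset.prod_eq_zero (Finset.mem_erase.2 ⟨hy.symm, Finset.mem_univ y₀⟩) h0, mul_zero]
  · simp

theorem analyticOnNhd_posteriorForm {𝒳 𝒴 : Type*} [Fintype 𝒳] [Fintype 𝒴] (c : 𝒴 → 𝒳 → ℝ)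
    (Q : 𝒳 → 𝒴 → ℝ) : AnalyticOnNhd ℝ (posteriorForm c Q) Set.univ := fun p _ =>
  Finset.analyticAt_fun_sum _ fun _ _ => (analyticAt_sum_mul _ p).mul
    (Finset.analyticAt_fun_prod _ fun _ _ => analyticAt_sum_mul _ p)

/-- For fixed coefficients which are not constant in `x`, the form does not vanish almost surely. -/
theorem GenericFunction.ae_posteriorForm_ne_zero {𝒳 𝒴 ℰ : Type*} [Fintype 𝒳] [Fintype 𝒴]
    [Fintype ℰ] {f : 𝒳 → ℰ → 𝒴} (hf : GenericFunction f) {c : 𝒴 → 𝒳 → ℝ} {y₀ : 𝒴} {x₁ x₂ : 𝒳}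
    (hc : c y₀ x₁ ≠ c y₀ x₂) :
    ∀ᵐ z ∂((uniformSimplex 𝒳).prod (uniformSimplex ℰ)),
      posteriorForm c (responseProb f fun e => z.2.1 e) (fun x => z.1.1 x) ≠ 0 := by
  have hmeas : MeasurableSet {z : probSimplex 𝒳 × probSimplex ℰ |
      posteriorForm c (responseProb f fun e => z.2.1 e) (fun x => z.1.1 x) ≠ 0} := by
    refine (isOpen_ne_fun ?_ continuous_const).measurableSet
    unfold posteriorForm responseProb
    fun_prop
  rw [Measure.ae_prod_iff_ae_ae hmeas]
  -- The order is exchanged so that `q` is fixed first: the nonvanishing `p` depends on it.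
  refine (Measure.ae_ae_comm (p := fun (p : probSimplex 𝒳) (q : probSimplex ℰ) =>
    posteriorForm c (responseProb f fun e => q.1 e) (fun x => p.1 x) ≠ 0) hmeas).2 ?_
  filter_upwards [hf.ae_genericResponse] with q hq
  obtain ⟨p, hp, hne⟩ := hq.exists_posteriorForm_ne_zero hc
  exact ae_uniformSimplex_ne_zero (analyticOnNhd_posteriorForm c _) hp hne

/-! ### Linear relations among deterministic maps. -/

/-- Fewer than `|𝒴| (|𝒳| - 1)` functions `𝒴 → 𝒳` satisfy a common linear relation whose
coefficients are not constant in `x`. -/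
theorem exists_relation_of_card_lt {𝒳 𝒴 ε : Type*} [Fintype 𝒳] [Fintype 𝒴] [Fintype ε]
    (g : 𝒴 → ε → 𝒳)
    (h : Fintype.card ε + Fintype.card 𝒴 < Fintype.card 𝒳 * Fintype.card 𝒴) :
    ∃ c : 𝒴 → 𝒳 → ℝ, (∀ e, ∑ y, c y (g y e) = 0) ∧ ∃ y x₁ x₂, c y x₁ ≠ c y x₂ := by
  obtain ⟨x₀⟩ : Nonempty 𝒳 := by
    by_contra hX
    rw [not_nonempty_iff] at hX
    simp at h
  -- The extra `𝒴` coordinates normalise `c y x₀ = 0`, so that a kernel element constant in `x` for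
  -- every `y` would be zero.
  let T : (𝒴 → 𝒳 → ℝ) →ₗ[ℝ] (ε ⊕ 𝒴 → ℝ) :=
    { toFun := fun c => Sum.elim (fun e => ∑ y, c y (g y e)) fun y => c y x₀
      map_add' := fun c d => by
        ext (e | y) <;> simp [Finset.sum_add_distrib]
      map_smul' := fun r c => by
        ext (e | y) <;> simp [Finset.mul_sum] }
  have hker : LinearMap.ker T ≠ ⊥ := LinearMap.ker_ne_bot_of_finrank_lt (by
    simpa [Module.finrank_pi_fintype, mul_comm] using h)
  obtain ⟨c, hc, hc0⟩ := (Submodule.ne_bot_iff _).1 hker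
  have hT : T c = 0 := hc
  refine ⟨c, fun e => congrFun hT (Sum.inl e), ?_⟩
  by_contra! hcon
  refine hc0 (funext fun y => funext fun x => ?_)
  rw [hcon y x x₀]
  exact congrFun hT (Sum.inr y)

/-! ### Existence of models, and the constraint imposed by a reverse model. -/

namespace CausalModel

theorem observed_eq_mul_responseProb {𝒞 𝒲 ℰ : Type*} [Fintype 𝒞] [Fintype ℰ]
    (M : CausalModel 𝒞 𝒲 ℰ) (c : 𝒞) (w : 𝒲) :
    M.observed c w = M.cause.1 c * responseProb M.f (fun e => M.exo.1 e) c w := by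
  classical
  simp only [observed, jointExo, responseProb, Finset.sum_filter, Finset.mul_sum, ite_mul, one_mul,
    zero_mul, mul_ite, mul_zero]

/-- Weighted sums over the effect of the response probabilities are expectations over the exogenous
variable. -/
theorem sum_mul_responseProb {𝒞 𝒲 ℰ : Type*} [Fintype 𝒲] [Fintype ℰ] (g : 𝒞 → ℰ → 𝒲)
    (q : ℰ → ℝ) (a : 𝒲 → ℝ) (c : 𝒞) :
    ∑ w, a w * responseProb g q c w = ∑ e, a (g c e) * q e := by
  classical
  simp only [responseProb, Finset.mul_sum]
  rw [Finset.sum_comm]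
  refine Finset.sum_congr rfl fun e _ => ?_
  simp

theorem sum_responseProb {𝒞 𝒲 ℰ : Type*} [Fintype 𝒲] [Fintype ℰ] (g : 𝒞 → ℰ → 𝒲)
    (q : probSimplex ℰ) (c : 𝒞) : ∑ w, responseProb g (fun e => q.1 e) c w = 1 := by
  have h := sum_mul_responseProb g (fun e => q.1 e) (fun _ => 1) c
  simp only [one_mul] at h
  rw [h, q.2.2]

theorem sum_observed {𝒞 𝒲 ℰ : Type*} [Fintype 𝒞] [Fintype 𝒲] [Fintype ℰ]
    (M : CausalModel 𝒞 𝒲 ℰ) (c : 𝒞) : ∑ w, M.observed c w = M.cause.1 c := by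
  simp_rw [observed_eq_mul_responseProb, ← Finset.mul_sum]
  rw [sum_responseProb, mul_one]

/-- The states of the exogenous variable may be relabelled as `Fin k`. -/
theorem exists_fin_observed_eq {𝒞 𝒲 ℰ : Type*} [Fintype 𝒞] [Fintype ℰ]
    (M : CausalModel 𝒞 𝒲 ℰ) :
    ∃ M' : CausalModel 𝒞 𝒲 (Fin (Fintype.card ℰ)), M'.observed = M.observed := by
  classical
  let e := (Fintype.equivFin ℰ).symm
  refine ⟨⟨M.cause, ⟨WithLp.toLp 2 fun i => M.exo.1 (e i), fun i => M.exo.2.1 (e i), ?_⟩,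
    fun c i => M.f c (e i)⟩, ?_⟩
  · exact (e.sum_comp fun j => M.exo.1 j).trans M.exo.2.2
  · funext c w
    rw [observed_eq_mul_responseProb, observed_eq_mul_responseProb]
    exact congrArg (M.cause.1 c * ·)
      (e.sum_comp fun j => (if M.f c j = w then 1 else 0) * M.exo.1 j)

theorem exists_isMinimalFor {𝒞 𝒲 ℰ : Type*} [Fintype 𝒞] [Fintype ℰ] (M : CausalModel 𝒞 𝒲 ℰ) :
    ∃ (k : ℕ) (M' : CausalModel 𝒞 𝒲 (Fin k)), M'.IsMinimalFor M.observed := by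
  classical
  have h : ∃ (k : ℕ) (M' : CausalModel 𝒞 𝒲 (Fin k)), M'.observed = M.observed :=
    ⟨_, M.exists_fin_observed_eq⟩
  obtain ⟨M', hM'⟩ := Nat.find_spec h
  refine ⟨_, M', hM', fun k M'' hM'' => ?_⟩
  rw [Fintype.card_fin]
  exact Nat.find_min' h ⟨M'', hM''⟩

/-- Every joint distribution in which the marginal of the first variable is positive is explained by
a causal model, whose exogenous variable is a random function. -/
theorem exists_observed_eq {𝒞 𝒲 : Type*} [Fintype 𝒞] [Fintype 𝒲] [DecidableEq 𝒞]
    (p : 𝒞 → 𝒲 → ℝ) (hp : ∀ c w, 0 ≤ p c w) (hsum : ∑ c, ∑ w, p c w = 1)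
    (hpos : ∀ c, 0 < ∑ w, p c w) : ∃ M : CausalModel 𝒞 𝒲 (𝒞 → 𝒲), M.observed = p := by
  classical
  have h1 : ∀ c, ∑ w, p c w / ∑ w', p c w' = 1 := fun c => by
    rw [← Finset.sum_div, div_self (hpos c).ne']
  -- The values `φ c` of the random function are independent, each with the conditional law of the
  -- effect given `c`.
  refine ⟨⟨⟨WithLp.toLp 2 fun c => ∑ w, p c w, fun c => (hpos c).le, hsum⟩,
    ⟨WithLp.toLp 2 fun φ => ∏ c, p c (φ c) / ∑ w, p c w, fun φ => ?_, ?_⟩, fun c φ => φ c⟩, ?_⟩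
  · exact Finset.prod_nonneg fun c _ => div_nonneg (hp _ _) (hpos c).le
  · change ∑ φ : 𝒞 → 𝒲, ∏ c, p c (φ c) / ∑ w, p c w = 1
    rw [← Fintype.prod_sum (fun c w => p c w / ∑ w', p c w')]
    simp [h1]
  · funext c₀ w₀
    rw [observed_eq_mul_responseProb]
    have hprod : ∀ φ : 𝒞 → 𝒲,
        (if φ c₀ = w₀ then 1 else 0) * ∏ c, p c (φ c) / ∑ w, p c w =
          ∏ c, (if c = c₀ then (if φ c = w₀ then 1 else 0) else 1) *
            (p c (φ c) / ∑ w, p c w) := fun φ => by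
      rw [Finset.prod_mul_distrib, Finset.prod_ite_eq' Finset.univ c₀]
      simp
    have hresp : responseProb (fun (c : 𝒞) (φ : 𝒞 → 𝒲) => φ c)
        (fun φ => ∏ c, p c (φ c) / ∑ w, p c w) c₀ w₀ = p c₀ w₀ / ∑ w, p c₀ w := by
      rw [responseProb, Finset.sum_congr rfl fun φ _ => hprod φ,
        ← Fintype.prod_sum (fun c w => (if c = c₀ then (if w = w₀ then 1 else 0) else 1) *
            (p c w / ∑ w', p c w')), Finset.prod_eq_single c₀]
      · simp
      · intro c _ hc
        simp [hc, h1]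
      · simp
    change (∑ w, p c₀ w) * responseProb (fun (c : 𝒞) (φ : 𝒞 → 𝒲) => φ c)
        (fun φ => ∏ c, p c (φ c) / ∑ w, p c w) c₀ w₀ = p c₀ w₀
    rw [hresp, mul_div_cancel₀ _ (hpos c₀).ne']

/-- A model in the reverse direction makes the form of every relation satisfied by its functions
vanish. -/
theorem posteriorForm_eq_zero {𝒳 𝒴 ℰ ε : Type*} [Fintype 𝒳] [Fintype 𝒴] [Fintype ℰ] [Fintype ε]
    (M : CausalModel 𝒳 𝒴 ℰ) (N : CausalModel 𝒴 𝒳 ε)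
    (hN : N.observed = fun y x => M.observed x y) {c : 𝒴 → 𝒳 → ℝ}
    (hc : ∀ e, ∑ y, c y (N.f y e) = 0) :
    posteriorForm c (responseProb M.f fun e => M.exo.1 e) (fun x => M.cause.1 x) = 0 := by
  classical
  have hden : ∀ y, ∑ x, responseProb M.f (fun e => M.exo.1 e) x y * M.cause.1 x =
      N.cause.1 y := fun y => by
    rw [← N.sum_observed y, hN]
    exact Finset.sum_congr rfl fun x _ =>
      (mul_comm _ _).trans (M.observed_eq_mul_responseProb x y).symm
  -- Both models give the same joint law, so the numerator for `y` is `P(y)` times the mean of `c y`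
  -- under the reverse mechanism.
  have hnum : ∀ y, ∑ x, c y x * responseProb M.f (fun e => M.exo.1 e) x y * M.cause.1 x =
      N.cause.1 y * ∑ e, c y (N.f y e) * N.exo.1 e := fun y => by
    rw [← sum_mul_responseProb N.f (fun e => N.exo.1 e) (c y) y, Finset.mul_sum]
    refine Finset.sum_congr rfl fun x _ => ?_
    have h := congrFun (congrFun hN y) x
    rw [observed_eq_mul_responseProb] at h
    simp only [observed_eq_mul_responseProb] at h
    rw [mul_left_comm, h]
    ring
  calc posteriorForm c (responseProb M.f fun e => M.exo.1 e) (fun x => M.cause.1 x)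
      = ∑ y, (∏ y', N.cause.1 y') * ∑ e, c y (N.f y e) * N.exo.1 e := by
        refine Finset.sum_congr rfl fun y _ => ?_
        simp only [hden, hnum]
        rw [← Finset.mul_prod_erase _ _ (Finset.mem_univ y)]
        ring
    _ = (∏ y', N.cause.1 y') * ∑ e, (∑ y, c y (N.f y e)) * N.exo.1 e := by
        rw [← Finset.mul_sum, Finset.sum_comm]
        simp only [Finset.sum_mul]
    _ = 0 := by simp [hc]

end CausalModel

end

/-! ### The comparison of cardinalities. -/

/-- The true model is `X → Y`, `Y = f(X, E₀)`, `|𝒳| = n`, `|𝒴| = m`, with `f` generic and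
`|E₀| < n(m - 1)`; the distributions `z.1` of `X` and `z.2` of `E₀` are drawn independently and
uniformly from the simplices. Almost surely, minimum-cardinality exogenous variables `E`
(for `X → Y`) and `Ẽ` (for `Y → X`) exist, and any choice of them satisfies
`|X| + |E| < |Y| + |Ẽ|`. -/
theorem mainTheorem9 {𝒳 𝒴 ℰ₀ : Type*} [Fintype 𝒳] [Fintype 𝒴] [Fintype ℰ₀]
    (n m : ℕ) (hn : Fintype.card 𝒳 = n) (hm : Fintype.card 𝒴 = m)
    (f : 𝒳 → ℰ₀ → 𝒴) (hf : GenericFunction f)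
    (hE₀ : (Fintype.card ℰ₀ : ℤ) < n * (m - 1)) :
    ∀ᵐ z ∂((uniformSimplex 𝒳).prod (uniformSimplex ℰ₀)),
      ∀ p : 𝒳 → 𝒴 → ℝ, p = (CausalModel.mk z.1 z.2 f).observed →
        (∃ (k : ℕ) (M : CausalModel 𝒳 𝒴 (Fin k)), M.IsMinimalFor p) ∧
        (∃ (l : ℕ) (N : CausalModel 𝒴 𝒳 (Fin l)), N.IsMinimalFor fun y x => p x y) ∧
        ∀ (k l : ℕ) (M : CausalModel 𝒳 𝒴 (Fin k)) (N : CausalModel 𝒴 𝒳 (Fin l)),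
          M.IsMinimalFor p → (N.IsMinimalFor fun y x => p x y) → n + k < m + l := by
  classical
  have hform : ∀ᵐ z ∂((uniformSimplex 𝒳).prod (uniformSimplex ℰ₀)),
      ∀ (l : ℕ) (g : 𝒴 → Fin l → 𝒳), l + m < n * m → ∃ c : 𝒴 → 𝒳 → ℝ,
        (∀ e, ∑ y, c y (g y e) = 0) ∧
          posteriorForm c (responseProb f fun e => z.2.1 e) (fun x => z.1.1 x) ≠ 0 := by
    simp_rw [ae_all_iff]
    intro l g hl
    obtain ⟨c, hc, y₀, x₁, x₂, hne⟩ := exists_relation_of_card_lt g (by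
      rwa [Fintype.card_fin, hn, hm])
    filter_upwards [hf.ae_posteriorForm_ne_zero hne] with z hz
    exact ⟨c, hc, hz⟩
  filter_upwards [hform, Measure.quasiMeasurePreserving_snd.ae hf.ae_genericResponse] with z hz hQ
  rintro p rfl
  set M₀ := CausalModel.mk z.1 z.2 f with hM₀
  have hp : ∀ x y, M₀.observed x y = z.1.1 x * responseProb f (fun e => z.2.1 e) x y :=
    M₀.observed_eq_mul_responseProb
  refine ⟨M₀.exists_isMinimalFor, ?_, fun k l M N hM hN => ?_⟩
  -- One cause of positive mass suffices: all its response probabilities are positive, so every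
  -- effect has positive probability.
  · obtain ⟨x₀, -, hx₀⟩ : ∃ x ∈ Finset.univ, z.1.1 x ≠ 0 :=
      Finset.exists_ne_zero_of_sum_ne_zero (by rw [z.1.2.2]; exact one_ne_zero)
    have h0 : ∀ x y, 0 ≤ M₀.observed x y := fun x y => by
      rw [hp]; exact mul_nonneg (z.1.2.1 x) (hQ.pos x y).le
    obtain ⟨N, hN⟩ := CausalModel.exists_observed_eq (fun y x => M₀.observed x y)
      (fun y x => h0 x y)
      (by rw [Finset.sum_comm]; simp_rw [CausalModel.sum_observed]; exact z.1.2.2)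
      (fun y => Finset.sum_pos' (fun x _ => h0 x y) ⟨x₀, Finset.mem_univ x₀, by
        rw [hp]
        exact mul_pos (lt_of_le_of_ne (z.1.2.1 x₀) hx₀.symm) (hQ.pos x₀ y)⟩)
    rw [← hN]
    exact N.exists_isMinimalFor
  · obtain ⟨M', hM'⟩ := M₀.exists_fin_observed_eq
    have hk := hM.2 _ M' hM'
    rw [Fintype.card_fin] at hk
    -- If `m + l ≤ n + k`, then `k ≤ |ℰ₀| < n(m - 1)` forces `l + m < nm`, the range excluded by
    -- `hform`.
    by_contra! hlt
    have hl : l + m < n * m := by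
      zify at hk hlt ⊢
      linarith
    obtain ⟨c, hc, hne⟩ := hz l N.f hl
    exact hne (M₀.posteriorForm_eq_zero N hN.1 hc)
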